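/- Work on $n$ qubits, i.e. with operators on $(\mathbb{C}^2)^{\otimes n}$. Let $\mathcal{P}$ be the set of tensor products $P_1\otimes\dots\otimes P_n$ of Pauli matrices $P_i\in\{I,\sigma_x,\sigma_y,\sigma_z\}$, let $\mathrm{supp}(P)=\{i: P_i\ne I\}$, and let $\mathcal{P}_K=\{P\in\mathcal{P}: |\mathrm{supp}(P)|\le K\}$. A $\mathfrak{k}$-local Hamiltonian is an operator $H=\sum_{a=1}^m\lambda_aE_a$ with real coefficients $\lambda_a$ and distinct, non-identity terms $E_a\in\mathcal{P}_{\mathfrak{k}}$. Its local norms are $$\|H\|_{1,\mathrm{loc}}=\max_{i\in[n]}\sum_{a:\,i\in\mathrm{supp}(E_a)}|\lambda_a|,\qquad \|H\|_{2,\mathrm{loc}}=\max_{i\in[n]}\Bigl(\sum_{a:\,i\in\mathrm{supp}(E_a)}|\lambda_a|^2\Bigr)^{1/2}.$$ Write $\|\cdot\|_F$ for the Frobenius norm and $[A,B]=AB-BA$. There is a universal constant $C$ such that the following holds for all nonnegative integers $n,m,\mathfrak{k},K$. Let $H=\sum_{a=1}^m\lambda_aE_a$ and $H_0=\sum_{a=1}^m\lambda^{(0)}_aE_a$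 be $\mathfrak{k}$-local Hamiltonians on $n$ qubits, with the same terms, such that $\|H\|_{1,\mathrm{loc}},\|H_0\|_{1,\mathrm{loc}}\le\mathfrak{d}$ and $\|H-H_0\|_{2,\mathrm{loc}}\le\eta$. Let $P\in\mathcal{P}_K$, and let $t\in\mathbb{R}$ satisfy $|t|\,\mathfrak{d}\,(K+\mathfrak{k})^C<1$. Then for every integer $s\ge 0$ with $s|t|\eta\le 1$, $$(e^{-iH_0t}e^{iHt})^s\,P\,(e^{-iHt}e^{iH_0t})^s=P+i\,s\,t\,[H-H_0,P]+E,$$ where $$\|E\|_F\le(\eta s t^2\mathfrak{d}+\eta^2s^2t^2)\,(K+\mathfrak{k})^{C\mathfrak{k}}\,\|P\|_F.$$ -/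

import Mathlib

/-- The labels of the four single-qubit Pauli matrices. -/
inductive PauliLabel where
  | id
  | x
  | y
  | z
  deriving DecidableEq

/-- The `2 × 2` Pauli matrices. -/
def PauliLabel.toMatrix : PauliLabel → Matrix (Fin 2) (Fin 2) ℂ
  | .id => !![1, 0; 0, 1]
  | .x => !![0, 1; 1, 0]
  | .y => !![0, -Complex.I; Complex.I, 0]
  | .z => !![1, 0; 0, -1]

/-- Operators on `n` qubits. The index type `Fin n → Fin 2` is the computational basis
of `ℂ² ⊗ ⋯ ⊗ ℂ²`, and has `2 ^ n` elements. -/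
abbrev QubitOp (n : ℕ) : Type := Matrix (Fin n → Fin 2) (Fin n → Fin 2) ℂ

/-- Tensor products of `n` Pauli matrices, given by their factors. -/
abbrev PauliString (n : ℕ) : Type := Fin n → PauliLabel

namespace PauliString

/-- The operator `P₁ ⊗ ⋯ ⊗ Pₙ`, in the computational basis. -/
def toOp {n : ℕ} (P : PauliString n) : QubitOp n :=
  Matrix.of fun v w => ∏ i, (P i).toMatrix (v i) (w i)

/-- The set of qubits on which `P₁ ⊗ ⋯ ⊗ Pₙ` acts non-trivially. -/
def supp {n : ℕ} (P : PauliString n) : Finset (Fin n) :=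
  Finset.univ.filter fun i => P i ≠ PauliLabel.id

end PauliString

/-- The operator `∑ₐ λₐ Eₐ`. -/
def hamiltonian {n m : ℕ} (E : Fin m → PauliString n) (c : Fin m → ℝ) : QubitOp n :=
  ∑ a, (c a : ℂ) • (E a).toOp

/-- The family `E` is an admissible family of terms of a `k`-local Hamiltonian: the terms are
distinct, different from the identity, and each acts on at most `k` qubits. -/
structure IsLocalTerms {n m : ℕ} (k : ℕ) (E : Fin m → PauliString n) : Prop where
  injective : Function.Injective E
  ne_id : ∀ a, E a ≠ fun _ => PauliLabel.id
  card_supp_le : ∀ a, (E a).supp.card ≤ k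

/-- The local one-norm: the maximum over the qubits `i` of `∑ |λₐ|` over the terms acting on `i`
(it is `0` if there are no qubits). -/
noncomputable def localOneNorm {n m : ℕ} (E : Fin m → PauliString n) (c : Fin m → ℝ) : ℝ :=
  ⨆ i : Fin n, ∑ a with i ∈ (E a).supp, |c a|

/-- The local two-norm: the maximum over the qubits `i` of `(∑ |λₐ|²)^{1/2}` over the terms
acting on `i` (it is `0` if there are no qubits). -/
noncomputable def localTwoNorm {n m : ℕ} (E : Fin m → PauliString n) (c : Fin m → ℝ) : ℝ :=
  ⨆ i : Fin n, √(∑ a with i ∈ (E a).supp, |c a| ^ 2)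

/-- The Frobenius norm `(∑ |Aᵢⱼ|²)^{1/2}`. -/
noncomputable def frobNorm {n : ℕ} (A : QubitOp n) : ℝ :=
  Matrix.frobeniusNormedAddCommGroup.toNorm.norm A

/-- The evolution `e^{i H t}`. -/
noncomputable def evolution {n : ℕ} (H : QubitOp n) (t : ℝ) : QubitOp n :=
  NormedSpace.exp ((Complex.I * (t : ℂ)) • H)

/-!
Write `V = H - H₀`, `x = K + k`, and let `Φ` be conjugation by `e^{-iH₀t} e^{iHt}`, an isometry for
the Frobenius norm. If `‖Φ P - P - it[V, P]‖ ≤ ε` and `‖Φ D - D‖ ≤ δ` for `D = it[V, P]`, then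
`‖Φ^s P - P - sD‖ ≤ sε + s²δ` (`norm_iterate_sub_sub_smul_le`). So only a single step has to be
analysed, and locality never has to be followed through the `s` steps.

In the interaction picture `Φ` is generated by `V` alone, and the mean value inequality bounds the
errors of one step by the norms of `[V, e^{iHτ} O e^{-iHτ}]` for `(K + k)`-local operators `O`
(`norm_interactionStep_sub_le`, `norm_interactionStep_sub_sub_le`). This commutator is expanded in
the nested commutators of `O` with `H`, using two estimates for a `K`-local operator `O`:

* `norm_lie_hamiltonian_le`: `‖[H, O]‖ ≤ 2 (K + k) d ‖O‖`, by Schur's test in the Pauli basis, since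
  a term that does not commute with a Pauli string meets the support of that string and of the
  product;
* `norm_lie_hamiltonian_le_of_localTwoNorm`: `‖[V, O]‖ ≤ 2 (4 (K + k) + 1) ^ (k + 1) η ‖O‖`. The
  terms `E a` contributing to the coefficient of a string `R` are grouped by their restriction to
  the support of `R`, and the Cauchy–Schwarz inequality is applied in each group. There are few
  groups, as such a restriction has weight at most `k` in a set of at most `K + k` qubits. A term
  `E b` contributing from `Q`, in the same group as `E a`, has each nontrivial factor equal to that
  of `E a` or that of `Q`, so there are few such `b` for given `a` and `Q`.

The `j`-th nested commutator is `(K + jk)`-local with norm at most `(2dx)^j j! ‖O‖`. The factorial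
cancels against the exponential series, and the growth of the second estimate with the locality is
absorbed by `(j + 1)^(k + 1) ≤ (k + 1)! e^(j + 1)`, which leaves a geometric series as long as
`|t| d x` is small (`norm_lie_heisenberg_le`).
-/

/-! ### Pauli matrices and Pauli strings -/

namespace PauliLabel

instance : Fintype PauliLabel := ⟨{.id, .x, .y, .z}, by intro a; cases a <;> decide⟩

/-- Multiplication of Pauli labels up to phase, i.e. the group law of `(ℤ/2)²`. -/
def mul : PauliLabel → PauliLabel → PauliLabel
  | .id, b => b
  | a, .id => a
  | .x, .x => .id
  | .x, .y => .z
  | .x, .z => .y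
  | .y, .x => .z
  | .y, .y => .id
  | .y, .z => .x
  | .z, .x => .y
  | .z, .y => .x
  | .z, .z => .id

instance : Mul PauliLabel := ⟨mul⟩

/-- The phase in the product of two Pauli matrices: `σ_a σ_b = phase a b • σ_{a * b}`. -/
noncomputable def phase : PauliLabel → PauliLabel → ℂ
  | .x, .y => Complex.I
  | .y, .x => -Complex.I
  | .y, .z => Complex.I
  | .z, .y => -Complex.I
  | .z, .x => Complex.I
  | .x, .z => -Complex.I
  | _, _ => 1

lemma mul_comm' (a b : PauliLabel) : a * b = b * a := by revert a b; decide

lemma mul_mul_cancel (a b : PauliLabel) : a * (a * b) = b := by revert a b; decide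

lemma mul_eq_id_iff (a b : PauliLabel) : a * b = .id ↔ a = b := by revert a b; decide

lemma norm_phase (a b : PauliLabel) : ‖phase a b‖ = 1 := by
  cases a <;> cases b <;> simp [phase]

lemma phase_comm {a b : PauliLabel} (h : a = .id ∨ b = .id ∨ a = b) :
    phase a b = phase b a := by
  cases a <;> cases b <;> simp_all [phase]

lemma toMatrix_mul (a b : PauliLabel) (i j : Fin 2) :
    ∑ l, a.toMatrix i l * b.toMatrix l j = phase a b * (a * b).toMatrix i j := by
  change _ = phase a b * (mul a b).toMatrix i j
  cases a <;> cases b <;> fin_cases i <;> fin_cases j <;>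
    simp [toMatrix, phase, mul, Fin.sum_univ_two]

lemma sum_toMatrix_conj (a b : PauliLabel) :
    ∑ i, ∑ j, a.toMatrix i j * (starRingEnd ℂ) (b.toMatrix i j) = if a = b then 2 else 0 := by
  cases a <;> cases b <;> simp [toMatrix, Fin.sum_univ_two] <;> norm_num

end PauliLabel

namespace PauliString

variable {n : ℕ}

lemma mul_comm' (P Q : PauliString n) : P * Q = Q * P :=
  funext fun i => PauliLabel.mul_comm' (P i) (Q i)

lemma mul_mul_cancel (P Q : PauliString n) : P * (P * Q) = Q :=
  funext fun i => PauliLabel.mul_mul_cancel (P i) (Q i)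

lemma mem_supp {P : PauliString n} {i : Fin n} : i ∈ P.supp ↔ P i ≠ .id := by simp [supp]

lemma supp_mul_subset (P Q : PauliString n) : (P * Q).supp ⊆ P.supp ∪ Q.supp := by
  intro i
  simp only [Finset.mem_union, mem_supp, Pi.mul_apply]
  generalize P i = a
  generalize Q i = b
  revert a b
  decide

/-- Left multiplication by a Pauli string, up to phase, is an involution. -/
def mulPerm (P : PauliString n) : Equiv.Perm (PauliString n) :=
  Function.Involutive.toPerm (fun Q => P * Q) (mul_mul_cancel P)

lemma sum_mul_left {M : Type*} [AddCommMonoid M] (P : PauliString n) (f : PauliString n → M) :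
    ∑ Q, f (P * Q) = ∑ Q, f Q :=
  Equiv.sum_comp (mulPerm P) f

lemma toOp_mul (P Q : PauliString n) :
    P.toOp * Q.toOp = (∏ i, PauliLabel.phase (P i) (Q i)) • (P * Q).toOp := by
  ext v w
  simp only [Matrix.mul_apply, toOp, Matrix.of_apply, Matrix.smul_apply, smul_eq_mul,
    ← Finset.prod_mul_distrib, Pi.mul_apply, ← PauliLabel.toMatrix_mul]
  rw [Finset.prod_univ_sum, Fintype.piFinset_univ]

/-- The coefficient of `P * Q` in the commutator of two Pauli strings. -/
noncomputable def commPhase (P Q : PauliString n) : ℂ :=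
  ∏ i, PauliLabel.phase (P i) (Q i) - ∏ i, PauliLabel.phase (Q i) (P i)

lemma lie_toOp (P Q : PauliString n) : ⁅P.toOp, Q.toOp⁆ = commPhase P Q • (P * Q).toOp := by
  rw [Ring.lie_def, toOp_mul, toOp_mul, mul_comm' Q P, ← sub_smul, commPhase]

lemma norm_commPhase_le (P Q : PauliString n) : ‖commPhase P Q‖ ≤ 2 := by
  refine (norm_sub_le _ _).trans ?_
  simp [norm_prod, PauliLabel.norm_phase]
  norm_num

/-- Two Pauli strings that do not commute carry distinct non-identity factors on some qubit. -/
lemma exists_of_commPhase_ne_zero {P Q : PauliString n} (h : commPhase P Q ≠ 0) :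
    ∃ i, i ∈ P.supp ∧ i ∈ Q.supp ∧ i ∈ (P * Q).supp := by
  by_contra! hc
  refine h (sub_eq_zero.2 (Finset.prod_congr rfl fun i _ => PauliLabel.phase_comm ?_))
  have := hc i
  simp only [mem_supp, Pi.mul_apply, ne_eq, PauliLabel.mul_eq_id_iff] at this
  tauto

lemma sum_toOp_conj (P Q : PauliString n) :
    ∑ v, ∑ w, P.toOp v w * (starRingEnd ℂ) (Q.toOp v w) = if P = Q then 2 ^ n else 0 := by
  have h : ∑ v, ∑ w, P.toOp v w * (starRingEnd ℂ) (Q.toOp v w) =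
      ∏ i, ∑ x, ∑ y, (P i).toMatrix x y * (starRingEnd ℂ) ((Q i).toMatrix x y) := by
    rw [Finset.prod_univ_sum, Fintype.piFinset_univ]
    refine Finset.sum_congr rfl fun v _ => ?_
    rw [Finset.prod_univ_sum, Fintype.piFinset_univ]
    simp [toOp, map_prod, Finset.prod_mul_distrib]
  rw [h]
  simp only [PauliLabel.sum_toMatrix_conj]
  split_ifs with hPQ
  · simp [hPQ]
  · obtain ⟨i, hi⟩ := Function.ne_iff.1 hPQ
    exact Finset.prod_eq_zero (Finset.mem_univ i) (by simp [hi])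

/-- There are at most `(4 |S| + 1) ^ k` Pauli strings of weight at most `k` supported in `S`. -/
lemma card_supp_subset_le (S : Finset (Fin n)) (k : ℕ) :
    (Finset.univ.filter fun F : PauliString n => F.supp ⊆ S ∧ F.supp.card ≤ k).card ≤
      (4 * S.card + 1) ^ k := by
  classical
  induction k with
  | zero =>
    rw [pow_zero, Finset.card_le_one]
    intro F hF G hG
    simp only [Finset.mem_filter, Nat.le_zero, Finset.card_eq_zero] at hF hG
    have key : ∀ F : PauliString n, F.supp = ∅ → F = fun _ => .id := by
      intro F h
      funext i
      by_contra hi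
      have := mem_supp.2 hi
      simp [h] at this
    rw [key F hF.2.2, key G hG.2.2]
  | succ k ih =>
    -- a string of weight at most `k + 1` either has weight at most `k`, or arises from one by
    -- setting a factor
    let T : Finset (Option (Fin n × PauliLabel)) :=
      Finset.insertNone (S ×ˢ (Finset.univ : Finset PauliLabel))
    let f : Option (Fin n × PauliLabel) → PauliString n → PauliString n := fun o F =>
      o.elim F fun p => Function.update F p.1 p.2
    have hT : T.card = 4 * S.card + 1 := by
      simp only [T, Finset.card_insertNone, Finset.card_product]
      rw [show (Finset.univ : Finset PauliLabel).card = 4 from rfl, mul_comm]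
    have hsub : (Finset.univ.filter fun F : PauliString n => F.supp ⊆ S ∧ F.supp.card ≤ k + 1) ⊆
        Finset.image₂ f T
          (Finset.univ.filter fun F : PauliString n => F.supp ⊆ S ∧ F.supp.card ≤ k) := by
      intro F hF
      simp only [Finset.mem_filter, Finset.mem_univ, true_and] at hF
      rw [Finset.mem_image₂]
      by_cases h0 : F.supp.card ≤ k
      · exact ⟨none, by simp [T], F, by simp [hF.1, h0], rfl⟩
      · have hne : F.supp.Nonempty := by
          rw [← Finset.card_pos]; omega
        obtain ⟨i, hi⟩ := hne
        have hs : supp (Function.update F i .id) = F.supp.erase i := by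
          ext j
          by_cases hj : j = i
          · subst hj; simp [mem_supp]
          · simp [mem_supp, hj]
        refine ⟨some (i, F i), ?_, Function.update F i .id, ?_, ?_⟩
        · simp [T, hF.1 hi]
        · simp only [Finset.mem_filter, Finset.mem_univ, true_and, hs, Finset.card_erase_of_mem hi]
          exact ⟨(Finset.erase_subset _ _).trans hF.1, by omega⟩
        · simp [f]
    refine (Finset.card_le_card hsub).trans ((Finset.card_image₂_le _ _ _).trans ?_)
    rw [hT, pow_succ, mul_comm]
    exact Nat.mul_le_mul_right _ ih

end PauliString

section Frobenius

open scoped Matrix.Norms.Frobenius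

variable {n m : ℕ}

lemma frobenius_norm_sq (A : QubitOp n) : ‖A‖ ^ 2 = ∑ v, ∑ w, ‖A v w‖ ^ 2 := by
  have h : (0 : ℝ) ≤ ∑ v, ∑ w, ‖A v w‖ ^ 2 := by positivity
  rw [Matrix.frobenius_norm_def, ← Real.sqrt_eq_rpow]
  simp only [Real.rpow_two]
  exact Real.sq_sqrt h

/-- Parseval's identity for the Pauli expansion. -/
lemma norm_sum_smul_toOp_sq (o : PauliString n → ℂ) :
    ‖∑ Q, o Q • Q.toOp‖ ^ 2 = 2 ^ n * ∑ Q, ‖o Q‖ ^ 2 := by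
  rw [frobenius_norm_sq]
  apply Complex.ofReal_injective
  push_cast
  simp only [← Complex.mul_conj', Matrix.sum_apply, Matrix.smul_apply, smul_eq_mul, map_sum,
    map_mul, Finset.sum_mul_sum]
  calc ∑ v, ∑ w, ∑ P : PauliString n, ∑ Q : PauliString n,
        o P * P.toOp v w * ((starRingEnd ℂ) (o Q) * (starRingEnd ℂ) (Q.toOp v w))
      = ∑ P : PauliString n, ∑ Q : PauliString n, o P * (starRingEnd ℂ) (o Q) *
          ∑ v, ∑ w, P.toOp v w * (starRingEnd ℂ) (Q.toOp v w) := by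
        simp only [Finset.mul_sum]
        rw [Finset.sum_congr rfl fun v _ => Finset.sum_comm, Finset.sum_comm]
        refine Finset.sum_congr rfl fun P _ => ?_
        rw [Finset.sum_congr rfl fun v _ => Finset.sum_comm, Finset.sum_comm]
        refine Finset.sum_congr rfl fun Q _ => Finset.sum_congr rfl fun v _ =>
          Finset.sum_congr rfl fun w _ => by ring
    _ = _ := by
        simp only [PauliString.sum_toOp_conj]
        simp [Finset.mul_sum, mul_comm]

end Frobenius

/-! ### Commutators in the Pauli basis -/

section Commutator

open scoped Matrix.Norms.Frobenius

variable {n m : ℕ}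

/-- `O` is a linear combination of Pauli strings of weight at most `K`. -/
def IsLocalOp (K : ℕ) (O : QubitOp n) : Prop :=
  ∃ o : PauliString n → ℂ, (∀ Q, o Q ≠ 0 → Q.supp.card ≤ K) ∧ O = ∑ Q, o Q • Q.toOp

lemma isLocalOp_toOp {K : ℕ} {P : PauliString n} (hP : P.supp.card ≤ K) :
    IsLocalOp K P.toOp := by
  classical
  refine ⟨Pi.single P 1, fun Q hQ => ?_, ?_⟩
  · by_cases h : Q = P
    · rwa [h]
    · simp [h] at hQ
  · simp [Pi.single_apply]

/-- The Pauli coefficients of `[∑ₐ cₐ Eₐ, ∑_Q o_Q Q]`. -/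
noncomputable def lieCoeff (E : Fin m → PauliString n) (c : Fin m → ℝ) (o : PauliString n → ℂ)
    (R : PauliString n) : ℂ :=
  ∑ a, (c a : ℂ) * (PauliString.commPhase (E a) (E a * R) * o (E a * R))

lemma lie_hamiltonian_sum (E : Fin m → PauliString n) (c : Fin m → ℝ) (o : PauliString n → ℂ) :
    ⁅hamiltonian E c, ∑ Q, o Q • Q.toOp⁆ = ∑ R, lieCoeff E c o R • R.toOp := by
  have h : ∀ a, ⁅(c a : ℂ) • (E a).toOp, ∑ Q, o Q • Q.toOp⁆ =
      ∑ R, ((c a : ℂ) * (PauliString.commPhase (E a) (E a * R) * o (E a * R))) • R.toOp := by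
    intro a
    conv_rhs => rw [← PauliString.sum_mul_left (E a)]
    simp only [PauliString.mul_mul_cancel]
    rw [Ring.lie_def, Finset.mul_sum, Finset.sum_mul, ← Finset.sum_sub_distrib]
    refine Finset.sum_congr rfl fun Q _ => ?_
    rw [smul_mul_smul_comm, smul_mul_smul_comm, mul_comm (o Q), ← smul_sub, ← Ring.lie_def,
      PauliString.lie_toOp, smul_smul]
    congr 1
    ring
  rw [hamiltonian, Ring.lie_def, Finset.sum_mul, Finset.mul_sum, ← Finset.sum_sub_distrib]
  simp only [← Ring.lie_def, h, lieCoeff, Finset.sum_smul]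
  exact Finset.sum_comm

/-- The support of a contributing product overlaps the term and has bounded size. -/
lemma exists_overlap_and_card_le {k K : ℕ} {E : Fin m → PauliString n} (hE : IsLocalTerms k E)
    {o : PauliString n → ℂ} (ho : ∀ Q, o Q ≠ 0 → Q.supp.card ≤ K) {a : Fin m} {R : PauliString n}
    (h1 : PauliString.commPhase (E a) (E a * R) ≠ 0) (h2 : o (E a * R) ≠ 0) :
    (∃ i ∈ R.supp, i ∈ (E a).supp) ∧ R.supp.card ≤ K + k := by
  constructor
  · obtain ⟨i, hi, -, hi'⟩ := PauliString.exists_of_commPhase_ne_zero h1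
    rw [PauliString.mul_mul_cancel] at hi'
    exact ⟨i, hi', hi⟩
  · have := PauliString.supp_mul_subset (E a) (E a * R)
    rw [PauliString.mul_mul_cancel] at this
    refine (Finset.card_le_card this).trans ((Finset.card_union_le _ _).trans ?_)
    have := hE.card_supp_le a
    have := ho _ h2
    omega

lemma isLocalOp_lie_hamiltonian {k K : ℕ} {E : Fin m → PauliString n} (hE : IsLocalTerms k E)
    (c : Fin m → ℝ) {O : QubitOp n} (hO : IsLocalOp K O) :
    IsLocalOp (K + k) ⁅hamiltonian E c, O⁆ := by
  obtain ⟨o, ho, rfl⟩ := hO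
  refine ⟨lieCoeff E c o, fun R hR => ?_, lie_hamiltonian_sum E c o⟩
  obtain ⟨a, -, ha⟩ := Finset.exists_ne_zero_of_sum_ne_zero hR
  simp only [ne_eq, mul_eq_zero, not_or] at ha
  exact (exists_overlap_and_card_le hE ho ha.2.1 ha.2.2).2

/-- A family of nonnegative weights whose total at each qubit is at most `D` has total at most
`|S| D` over the terms meeting `S`. -/
lemma sum_overlap_le (E : Fin m → PauliString n) {f : Fin m → ℝ} (hf : ∀ a, 0 ≤ f a) {D : ℝ}
    (hD : ∀ i, ∑ a with i ∈ (E a).supp, f a ≤ D) (S : Finset (Fin n)) :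
    ∑ a with ∃ i ∈ S, i ∈ (E a).supp, f a ≤ S.card * D := by
  classical
  calc ∑ a with ∃ i ∈ S, i ∈ (E a).supp, f a
      ≤ ∑ a, ∑ i ∈ S, if i ∈ (E a).supp then f a else 0 := by
        rw [Finset.sum_filter]
        refine Finset.sum_le_sum fun a _ => ?_
        split_ifs with h
        · obtain ⟨i, hi, hia⟩ := h
          calc f a = if i ∈ (E a).supp then f a else 0 := by simp [hia]
            _ ≤ _ := Finset.single_le_sum (f := fun i => if i ∈ (E a).supp then f a else 0)
              (fun j _ => by split_ifs <;> simp [hf a]) hi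
        · exact Finset.sum_nonneg fun j _ => by split_ifs <;> simp [hf a]
    _ = ∑ i ∈ S, ∑ a with i ∈ (E a).supp, f a := by
        rw [Finset.sum_comm]
        simp only [Finset.sum_filter]
    _ ≤ S.card * D := by
        rw [← nsmul_eq_mul]
        exact Finset.sum_le_card_nsmul _ _ _ fun i _ => hD i

lemma localOneNorm_nonneg (E : Fin m → PauliString n) (c : Fin m → ℝ) : 0 ≤ localOneNorm E c :=
  Real.iSup_nonneg fun _ => by positivity

lemma localTwoNorm_nonneg (E : Fin m → PauliString n) (c : Fin m → ℝ) : 0 ≤ localTwoNorm E c :=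
  Real.iSup_nonneg fun _ => by positivity

lemma sum_abs_le_localOneNorm (E : Fin m → PauliString n) (c : Fin m → ℝ) (i : Fin n) :
    ∑ a with i ∈ (E a).supp, |c a| ≤ localOneNorm E c :=
  le_ciSup (f := fun i : Fin n => ∑ a with i ∈ (E a).supp, |c a|) (Set.finite_range _).bddAbove i

lemma sum_abs_sq_le_localTwoNorm (E : Fin m → PauliString n) (c : Fin m → ℝ) (i : Fin n) :
    ∑ a with i ∈ (E a).supp, |c a| ^ 2 ≤ localTwoNorm E c ^ 2 := by
  have h := le_ciSup (f := fun i : Fin n => √(∑ a with i ∈ (E a).supp, |c a| ^ 2))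
    (Set.finite_range _).bddAbove i
  exact (Real.sqrt_le_left (localTwoNorm_nonneg E c)).1 h

/-- Reindexing of the sums over pairs of a term and a Pauli string. -/
lemma sum_sum_ite_commPhase (E : Fin m → PauliString n) (o : PauliString n → ℂ)
    (f : Fin m → PauliString n → ℝ) :
    ∑ R, ∑ a with PauliString.commPhase (E a) (E a * R) ≠ 0, f a R * ‖o (E a * R)‖ ^ 2 =
      ∑ Q, ‖o Q‖ ^ 2 * ∑ a with PauliString.commPhase (E a) Q ≠ 0, f a (E a * Q) := by
  simp only [Finset.sum_filter]
  rw [Finset.sum_comm]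
  have h : ∀ a, ∑ R, (if PauliString.commPhase (E a) (E a * R) ≠ 0 then
      f a R * ‖o (E a * R)‖ ^ 2 else 0) =
      ∑ Q, if PauliString.commPhase (E a) Q ≠ 0 then f a (E a * Q) * ‖o Q‖ ^ 2 else 0 := by
    intro a
    rw [← PauliString.sum_mul_left (E a)]
    simp only [PauliString.mul_mul_cancel]
  simp only [h]
  rw [Finset.sum_comm]
  refine Finset.sum_congr rfl fun Q _ => ?_
  rw [Finset.mul_sum]
  refine Finset.sum_congr rfl fun a _ => ?_
  split_ifs <;> ring

/-- Only terms that do not commute with their partner contribute to a Pauli coefficient of the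
commutator. -/
lemma norm_lieCoeff_le (E : Fin m → PauliString n) (c : Fin m → ℝ) (o : PauliString n → ℂ)
    (R : PauliString n) :
    ‖lieCoeff E c o R‖ ≤ ∑ a with PauliString.commPhase (E a) (E a * R) ≠ 0 ∧ o (E a * R) ≠ 0,
      |c a| * (2 * ‖o (E a * R)‖) := by
  rw [Finset.sum_filter]
  refine (norm_sum_le _ _).trans (Finset.sum_le_sum fun a _ => ?_)
  rw [norm_mul, norm_mul, Complex.norm_real, Real.norm_eq_abs]
  split_ifs with h
  · gcongr
    exact PauliString.norm_commPhase_le _ _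
  · have : PauliString.commPhase (E a) (E a * R) = 0 ∨ o (E a * R) = 0 := by tauto
    rcases this with h | h <;> simp [h]

/-- A commutator bound from a bound on the Pauli coefficients. -/
lemma norm_lie_le_of_lieCoeff {E : Fin m → PauliString n} {c : Fin m → ℝ} {o : PauliString n → ℂ}
    {M : ℝ} (hM : 0 ≤ M) (h : ∑ R, ‖lieCoeff E c o R‖ ^ 2 ≤ M ^ 2 * ∑ Q, ‖o Q‖ ^ 2) :
    ‖⁅hamiltonian E c, ∑ Q, o Q • Q.toOp⁆‖ ≤ M * ‖∑ Q, o Q • Q.toOp‖ := by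
  rw [← abs_of_nonneg (norm_nonneg ⁅hamiltonian E c, ∑ Q, o Q • Q.toOp⁆)]
  refine abs_le_of_sq_le_sq ?_ (by positivity)
  rw [lie_hamiltonian_sum, mul_pow, norm_sum_smul_toOp_sq, norm_sum_smul_toOp_sq]
  nlinarith [pow_pos (two_pos : (0 : ℝ) < 2) n]

/-- The local one-norm controls commutators, by Schur's test: a term contributes to the row (or
column) of a Pauli string only if it meets its support. -/
lemma norm_lie_hamiltonian_le {k K : ℕ} {E : Fin m → PauliString n} (hE : IsLocalTerms k E)
    {c : Fin m → ℝ} {d : ℝ} (hd : localOneNorm E c ≤ d) {O : QubitOp n} (hO : IsLocalOp K O) :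
    ‖⁅hamiltonian E c, O⁆‖ ≤ 2 * (K + k) * d * ‖O‖ := by
  obtain ⟨o, ho, rfl⟩ := hO
  have hd0 : 0 ≤ d := (localOneNorm_nonneg E c).trans hd
  refine norm_lie_le_of_lieCoeff (by positivity) ?_
  have hsum := sum_overlap_le E (f := fun a => |c a|) (fun a => abs_nonneg _)
    (fun i => (sum_abs_le_localOneNorm E c i).trans hd)
  have hR : ∀ R, ‖lieCoeff E c o R‖ ^ 2 ≤ (K + k) * d *
      ∑ a with PauliString.commPhase (E a) (E a * R) ≠ 0, (4 * |c a|) * ‖o (E a * R)‖ ^ 2 := by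
    intro R
    set A := Finset.univ.filter fun a =>
      PauliString.commPhase (E a) (E a * R) ≠ 0 ∧ o (E a * R) ≠ 0 with hA
    have hA1 : ∑ a ∈ A, |c a| ≤ (K + k) * d := by
      rcases A.eq_empty_or_nonempty with h0 | ⟨a, ha⟩
      · rw [h0]; simp only [Finset.sum_empty]; positivity
      · have hc : R.supp.card ≤ K + k := by
          simp only [hA, Finset.mem_filter] at ha
          exact (exists_overlap_and_card_le hE ho ha.2.1 ha.2.2).2
        have hc' : (R.supp.card : ℝ) ≤ K + k := by exact_mod_cast hc
        refine (Finset.sum_le_sum_of_subset_of_nonneg ?_ fun _ _ _ => abs_nonneg _).trans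
          ((hsum R.supp).trans (by gcongr))
        intro b hb
        simp only [hA, Finset.mem_filter, Finset.mem_univ, true_and] at hb ⊢
        exact (exists_overlap_and_card_le hE ho hb.1 hb.2).1
    have hA2 : ∑ a ∈ A, (4 * |c a|) * ‖o (E a * R)‖ ^ 2 ≤
        ∑ a with PauliString.commPhase (E a) (E a * R) ≠ 0, (4 * |c a|) * ‖o (E a * R)‖ ^ 2 :=
      Finset.sum_le_sum_of_subset_of_nonneg
        (fun b hb => by
          simp only [hA, Finset.mem_filter, Finset.mem_univ, true_and] at hb ⊢; exact hb.1)
        fun _ _ _ => by positivity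
    calc ‖lieCoeff E c o R‖ ^ 2 ≤ (∑ a ∈ A, |c a| * (2 * ‖o (E a * R)‖)) ^ 2 := by
          gcongr; exact norm_lieCoeff_le E c o R
      _ ≤ (∑ a ∈ A, |c a|) * ∑ a ∈ A, (4 * |c a|) * ‖o (E a * R)‖ ^ 2 :=
          Finset.sum_sq_le_sum_mul_sum_of_sq_le_mul _ (fun _ _ => abs_nonneg _)
            (fun _ _ => by positivity) (fun _ _ => le_of_eq (by ring))
      _ ≤ _ := by gcongr
  calc ∑ R, ‖lieCoeff E c o R‖ ^ 2
      ≤ ∑ R, (K + k) * d * ∑ a with PauliString.commPhase (E a) (E a * R) ≠ 0,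
          (4 * |c a|) * ‖o (E a * R)‖ ^ 2 := Finset.sum_le_sum fun R _ => hR R
    _ = (K + k) * d * ∑ Q, ‖o Q‖ ^ 2 *
          ∑ a with PauliString.commPhase (E a) Q ≠ 0, 4 * |c a| := by
        rw [← Finset.mul_sum, sum_sum_ite_commPhase E o fun a _ => 4 * |c a|]
    _ ≤ (K + k) * d * ∑ Q, ‖o Q‖ ^ 2 * (4 * ((K + k) * d)) := by
        refine mul_le_mul_of_nonneg_left (Finset.sum_le_sum fun Q _ => ?_) (by positivity)
        by_cases h0 : o Q = 0
        · simp [h0]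
        gcongr
        rw [← Finset.mul_sum]
        gcongr
        have hc : (Q.supp.card : ℝ) ≤ K + k := by
          have : (Q.supp.card : ℝ) ≤ K := by exact_mod_cast ho Q h0
          have : (0 : ℝ) ≤ k := by positivity
          linarith
        refine (Finset.sum_le_sum_of_subset_of_nonneg ?_ fun _ _ _ => abs_nonneg _).trans
          ((hsum Q.supp).trans (by gcongr))
        intro b hb
        simp only [Finset.mem_filter, Finset.mem_univ, true_and] at hb ⊢
        obtain ⟨i, hi, hi', -⟩ := PauliString.exists_of_commPhase_ne_zero hb
        exact ⟨i, hi', hi⟩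
    _ = (2 * (K + k) * d) ^ 2 * ∑ Q, ‖o Q‖ ^ 2 := by
        rw [← Finset.sum_mul]; ring

/-- The restriction of a Pauli string to the support of `R`. -/
def PauliString.restrict (R F : PauliString n) : PauliString n :=
  fun i => if R i = .id then .id else F i

lemma PauliString.supp_restrict_subset (R F : PauliString n) :
    (R.restrict F).supp ⊆ R.supp ∩ F.supp := by
  intro i
  simp only [Finset.mem_inter, PauliString.mem_supp, PauliString.restrict]
  split_ifs with h <;> simp [h]

/-- If `E b` agrees with `E a` on the support of `E b * Q`, then each factor of `E b` is the
identity, that of `E a` or that of `Q`. This leaves few possible `b` for given `a` and `Q`. -/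
lemma card_restrict_eq_le {k L : ℕ} {E : Fin m → PauliString n} (hE : IsLocalTerms k E)
    (Q : PauliString n) (a : Fin m) (hL : Q.supp.card + k ≤ L) :
    (Finset.univ.filter fun b =>
      (E b * Q).restrict (E a) = (E b * Q).restrict (E b)).card ≤ (4 * L + 1) ^ k := by
  classical
  have hS : ((E a).supp ∪ Q.supp).card ≤ L := by
    have := Finset.card_union_le (E a).supp Q.supp
    have := hE.card_supp_le a
    omega
  rw [← Finset.card_image_of_injective _ hE.injective]
  refine (Finset.card_le_card ?_).trans
    ((PauliString.card_supp_subset_le ((E a).supp ∪ Q.supp) k).trans (by gcongr))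
  intro F hF
  simp only [Finset.mem_image, Finset.mem_filter, Finset.mem_univ, true_and] at hF ⊢
  obtain ⟨b, hb, rfl⟩ := hF
  refine ⟨fun i hi => ?_, hE.card_supp_le b⟩
  rw [Finset.mem_union, PauliString.mem_supp, PauliString.mem_supp]
  rw [PauliString.mem_supp] at hi
  have hbi := congrFun hb i
  simp only [PauliString.restrict, Pi.mul_apply, PauliLabel.mul_eq_id_iff] at hbi
  split_ifs at hbi with h
  · exact Or.inr (h ▸ hi)
  · exact Or.inl (hbi ▸ hi)

/-- The square of a sum, by the Cauchy–Schwarz inequality over the classes of a map with at most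
`N` values and within each class. -/
lemma sq_sum_mul_le_of_card_image_le {ι κ : Type*} [DecidableEq κ] (A : Finset ι) (g : ι → κ)
    (x y : ι → ℝ) {N : ℝ} (hN : ((A.image g).card : ℝ) ≤ N) :
    (∑ a ∈ A, x a * y a) ^ 2 ≤ N * ∑ b ∈ A, (∑ a ∈ A with g a = g b, x a ^ 2) * y b ^ 2 := by
  have hmaps : ∀ a ∈ A, g a ∈ A.image g := fun a ha => Finset.mem_image_of_mem g ha
  calc (∑ a ∈ A, x a * y a) ^ 2
      = (∑ F ∈ A.image g, ∑ a ∈ A with g a = F, x a * y a) ^ 2 := by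
        rw [Finset.sum_fiberwise_of_maps_to hmaps]
    _ ≤ (A.image g).card * ∑ F ∈ A.image g, (∑ a ∈ A with g a = F, x a * y a) ^ 2 :=
        sq_sum_le_card_mul_sum_sq
    _ ≤ N * ∑ F ∈ A.image g, (∑ a ∈ A with g a = F, x a ^ 2) *
          ∑ b ∈ A with g b = F, y b ^ 2 := by
        refine mul_le_mul hN ?_ (Finset.sum_nonneg fun _ _ => sq_nonneg _)
          ((Nat.cast_nonneg _).trans hN)
        exact Finset.sum_le_sum fun F _ => Finset.sum_mul_sq_le_sq_mul_sq _ _ _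
    _ = N * ∑ b ∈ A, (∑ a ∈ A with g a = g b, x a ^ 2) * y b ^ 2 := by
        rw [← Finset.sum_fiberwise_of_maps_to hmaps]
        congr 1
        refine Finset.sum_congr rfl fun F _ => ?_
        rw [Finset.mul_sum]
        refine Finset.sum_congr rfl fun b hb => ?_
        rw [(Finset.mem_filter.1 hb).2]

/-- The local two-norm controls commutators with local operators. The contributions to the
coefficient of a Pauli string `R` are grouped by the restriction of the term to the support of
`R`, and the number of classes and their overlaps are bounded by counting Pauli strings. -/
lemma norm_lie_hamiltonian_le_of_localTwoNorm {k K : ℕ} {E : Fin m → PauliString n}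
    (hE : IsLocalTerms k E) {v : Fin m → ℝ} {η : ℝ} (hη : localTwoNorm E v ≤ η) {O : QubitOp n}
    (hO : IsLocalOp K O) :
    ‖⁅hamiltonian E v, O⁆‖ ≤ 2 * (4 * (K + k) + 1) ^ (k + 1) * η * ‖O‖ := by
  classical
  obtain ⟨o, ho, rfl⟩ := hO
  have hη0 : 0 ≤ η := (localTwoNorm_nonneg E v).trans hη
  refine norm_lie_le_of_lieCoeff (by positivity) ?_
  have hsum := sum_overlap_le E (f := fun a => |v a| ^ 2) (fun a => by positivity)
    (fun i => (sum_abs_sq_le_localTwoNorm E v i).trans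
      (pow_le_pow_left₀ (localTwoNorm_nonneg E v) hη 2))
  set N : ℝ := (4 * (K + k) + 1) ^ k with hN
  have hR : ∀ R, ‖lieCoeff E v o R‖ ^ 2 ≤ N *
      ∑ b with PauliString.commPhase (E b) (E b * R) ≠ 0,
        (4 * ∑ a with R.restrict (E a) = R.restrict (E b) ∧ ∃ i ∈ (E b * R).supp, i ∈ (E a).supp,
          |v a| ^ 2) * ‖o (E b * R)‖ ^ 2 := by
    intro R
    set A := Finset.univ.filter fun a =>
      PauliString.commPhase (E a) (E a * R) ≠ 0 ∧ o (E a * R) ≠ 0 with hA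
    have hA1 : (((A.image fun a => R.restrict (E a)).card : ℕ) : ℝ) ≤ N := by
      rcases A.eq_empty_or_nonempty with h0 | ⟨a, ha⟩
      · rw [h0, Finset.image_empty, Finset.card_empty, Nat.cast_zero]; positivity
      · have hc : R.supp.card ≤ K + k := by
          simp only [hA, Finset.mem_filter] at ha
          exact (exists_overlap_and_card_le hE ho ha.2.1 ha.2.2).2
        have : (A.image fun a => R.restrict (E a)).card ≤ (4 * (K + k) + 1) ^ k := by
          refine (Finset.card_le_card ?_).trans
            ((PauliString.card_supp_subset_le R.supp k).trans (by gcongr))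
          intro F hF
          simp only [Finset.mem_image, Finset.mem_filter, Finset.mem_univ, true_and] at hF ⊢
          obtain ⟨b, -, rfl⟩ := hF
          have hsub := PauliString.supp_restrict_subset R (E b)
          exact ⟨hsub.trans Finset.inter_subset_left, (Finset.card_le_card
            (hsub.trans Finset.inter_subset_right)).trans (hE.card_supp_le b)⟩
        rw [hN]
        exact_mod_cast this
    calc ‖lieCoeff E v o R‖ ^ 2 ≤ (∑ a ∈ A, |v a| * (2 * ‖o (E a * R)‖)) ^ 2 := by
          gcongr; exact norm_lieCoeff_le E v o R
      _ ≤ N * ∑ b ∈ A, (∑ a ∈ A with R.restrict (E a) = R.restrict (E b), |v a| ^ 2) *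
            (2 * ‖o (E b * R)‖) ^ 2 :=
          sq_sum_mul_le_of_card_image_le A (fun a => R.restrict (E a)) _ _ hA1
      _ ≤ N * ∑ b ∈ A, (4 * ∑ a with R.restrict (E a) = R.restrict (E b) ∧
            ∃ i ∈ (E b * R).supp, i ∈ (E a).supp, |v a| ^ 2) * ‖o (E b * R)‖ ^ 2 := by
          gcongr N * ?_
          refine Finset.sum_le_sum fun b hb => ?_
          simp only [hA, Finset.mem_filter, Finset.mem_univ, true_and] at hb
          rw [mul_pow, show (2 : ℝ) ^ 2 = 4 by norm_num, ← mul_assoc, mul_comm _ (4 : ℝ)]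
          gcongr 4 * ?_ * _
          refine Finset.sum_le_sum_of_subset_of_nonneg ?_ fun _ _ _ => by positivity
          intro a ha
          simp only [hA, Finset.mem_filter, Finset.mem_univ, true_and] at ha ⊢
          refine ⟨ha.2, ?_⟩
          obtain ⟨i, hi, hi', hi''⟩ := PauliString.exists_of_commPhase_ne_zero hb.1
          rw [PauliString.mul_mul_cancel] at hi''
          refine ⟨i, hi', ?_⟩
          have h := congrFun ha.2 i
          rw [PauliString.mem_supp] at hi hi'' ⊢
          simp only [PauliString.restrict, hi'', if_false] at h
          rwa [h]
      _ ≤ _ := by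
          gcongr N * ?_
          refine Finset.sum_le_sum_of_subset_of_nonneg ?_ fun _ _ _ => by positivity
          intro b hb
          simp only [hA, Finset.mem_filter, Finset.mem_univ, true_and] at hb ⊢
          exact hb.1
  have hQ : ∀ Q, o Q ≠ 0 → ∑ b with PauliString.commPhase (E b) Q ≠ 0,
      (4 * ∑ a with (E b * Q).restrict (E a) = (E b * Q).restrict (E b) ∧
        ∃ i ∈ (E b * (E b * Q)).supp, i ∈ (E a).supp, |v a| ^ 2) ≤ 4 * (N * (K * η ^ 2)) := by
    intro Q hQ
    rw [← Finset.mul_sum]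
    gcongr
    calc ∑ b with PauliString.commPhase (E b) Q ≠ 0,
          ∑ a with (E b * Q).restrict (E a) = (E b * Q).restrict (E b) ∧
            ∃ i ∈ (E b * (E b * Q)).supp, i ∈ (E a).supp, |v a| ^ 2
        ≤ ∑ b, ∑ a with (E b * Q).restrict (E a) = (E b * Q).restrict (E b) ∧
            ∃ i ∈ (E b * (E b * Q)).supp, i ∈ (E a).supp, |v a| ^ 2 :=
          Finset.sum_le_sum_of_subset_of_nonneg (Finset.filter_subset _ _)
            fun _ _ _ => by positivity
      _ = ∑ a with ∃ i ∈ Q.supp, i ∈ (E a).supp,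
            ∑ b with (E b * Q).restrict (E a) = (E b * Q).restrict (E b), |v a| ^ 2 := by
          simp only [PauliString.mul_mul_cancel, Finset.sum_filter]
          rw [Finset.sum_comm]
          refine Finset.sum_congr rfl fun a _ => ?_
          by_cases h : ∃ i ∈ Q.supp, i ∈ (E a).supp
          · simp only [h, and_true, if_true]
          · simp only [h, and_false, if_false, Finset.sum_const_zero]
      _ ≤ ∑ a with ∃ i ∈ Q.supp, i ∈ (E a).supp, N * |v a| ^ 2 := by
          refine Finset.sum_le_sum fun a _ => ?_
          rw [Finset.sum_const, nsmul_eq_mul]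
          gcongr
          have := card_restrict_eq_le hE Q a (Nat.add_le_add_right (ho Q hQ) k)
          rw [hN]
          exact_mod_cast this
      _ ≤ N * (K * η ^ 2) := by
          rw [← Finset.mul_sum]
          gcongr
          have hc : (Q.supp.card : ℝ) ≤ K := by exact_mod_cast ho Q hQ
          exact (hsum Q.supp).trans (by gcongr)
  calc ∑ R, ‖lieCoeff E v o R‖ ^ 2 ≤ _ := Finset.sum_le_sum fun R _ => hR R
    _ = N * ∑ Q, ‖o Q‖ ^ 2 * ∑ b with PauliString.commPhase (E b) Q ≠ 0,
      (4 * ∑ a with (E b * Q).restrict (E a) = (E b * Q).restrict (E b) ∧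
        ∃ i ∈ (E b * (E b * Q)).supp, i ∈ (E a).supp, |v a| ^ 2) := by
        rw [← Finset.mul_sum, sum_sum_ite_commPhase E o fun b R =>
          4 * ∑ a with R.restrict (E a) = R.restrict (E b) ∧
            ∃ i ∈ (E b * R).supp, i ∈ (E a).supp, |v a| ^ 2]
    _ ≤ N * ∑ Q, ‖o Q‖ ^ 2 * (4 * (N * (K * η ^ 2))) := by
        refine mul_le_mul_of_nonneg_left (Finset.sum_le_sum fun Q _ => ?_) (by positivity)
        by_cases h0 : o Q = 0
        · simp [h0]
        gcongr
        exact hQ Q h0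
    _ = (4 * N ^ 2 * η ^ 2 * ∑ Q, ‖o Q‖ ^ 2) * K := by
        rw [← Finset.sum_mul]; ring
    _ ≤ (4 * N ^ 2 * η ^ 2 * ∑ Q, ‖o Q‖ ^ 2) * (4 * (K + k) + 1) ^ 2 := by
        gcongr
        have h1 : (0 : ℝ) ≤ K := by positivity
        have h2 : (0 : ℝ) ≤ k := by positivity
        nlinarith [mul_nonneg h1 h2]
    _ = (2 * (4 * (K + k) + 1) ^ (k + 1) * η) ^ 2 * ∑ Q, ‖o Q‖ ^ 2 := by
        rw [hN]; ring

end Commutator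

/-! ### Calculus in Banach algebras -/

/-- Mean value inequality on the interval between `0` and `t`, for either sign of `t`. -/
lemma norm_sub_le_of_hasDerivAt {A : Type*} [NormedAddCommGroup A] [NormedSpace ℝ A]
    {f f' : ℝ → A} {t B : ℝ} (hf : ∀ τ, HasDerivAt f (f' τ) τ)
    (hB : ∀ τ, |τ| ≤ |t| → ‖f' τ‖ ≤ B) : ‖f t - f 0‖ ≤ |t| * B := by
  have h := Convex.norm_image_sub_le_of_norm_hasDerivWithin_le (f := f) (f' := f')
    (s := Set.Icc (-|t|) |t|) (x := 0) (y := t) (C := B)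
    (fun x _ => (hf x).hasDerivWithinAt) (fun x hx => hB x (abs_le.2 hx)) (convex_Icc _ _)
    (by simp) (abs_le.1 le_rfl)
  simpa [mul_comm] using h

section BanachAlgebra

variable {A : Type*} [NormedRing A] [NormedAlgebra ℂ A]

lemma commute_exp_smul (X : A) (z : ℂ) : Commute X (NormedSpace.exp (z • X)) :=
  ((Commute.refl X).smul_left z).exp_left.symm

lemma hasSum_smul_lie {z : ℕ → ℂ} {f : ℕ → A} {x : A} (V : A) (h : HasSum (fun j => z j • f j) x) :
    HasSum (fun j => z j • ⁅V, f j⁆) ⁅V, x⁆ := by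
  simpa only [Ring.lie_def, smul_sub, mul_smul_comm, smul_mul_assoc] using
    (h.mul_left V).sub (h.mul_right V)

lemma hasDerivAt_lie {f : ℝ → A} {f' : A} {t : ℝ} (V : A) (h : HasDerivAt f (Complex.I • f') t) :
    HasDerivAt (fun τ => ⁅V, f τ⁆) (Complex.I • ⁅V, f'⁆) t := by
  have h' := (h.const_mul V).sub (h.mul_const V)
  simp only [mul_smul_comm, smul_mul_assoc, ← smul_sub] at h'
  exact h'

lemma hasDerivAt_I_mul_smul (Y : A) (t : ℝ) :
    HasDerivAt (fun τ : ℝ => (Complex.I * (τ : ℂ)) • Y) (Complex.I • Y) t := by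
  have h : HasDerivAt (fun τ : ℝ => τ • (Complex.I • Y)) ((1 : ℝ) • (Complex.I • Y)) t :=
    (hasDerivAt_id t).smul_const _
  rw [one_smul] at h
  convert h using 2 with τ
  rw [mul_comm, mul_smul, Complex.coe_smul]

variable [CompleteSpace A]

lemma hasDerivAt_exp_I_smul (X : A) (t : ℝ) :
    HasDerivAt (fun τ : ℝ => NormedSpace.exp ((Complex.I * (τ : ℂ)) • X))
      ((Complex.I • X) * NormedSpace.exp ((Complex.I * (t : ℂ)) • X)) t := by
  have h := hasDerivAt_exp_smul_const' (𝕂 := ℝ) (Complex.I • X) t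
  have e : ∀ τ : ℝ, (Complex.I * (τ : ℂ)) • X = τ • (Complex.I • X) := by
    intro τ
    rw [mul_comm, mul_smul, Complex.coe_smul]
  simp only [e]
  exact h

lemma hasDerivAt_exp_I_neg_smul (X : A) (t : ℝ) :
    HasDerivAt (fun τ : ℝ => NormedSpace.exp ((Complex.I * ((-τ : ℝ) : ℂ)) • X))
      (-((Complex.I • X) * NormedSpace.exp ((Complex.I * ((-t : ℝ) : ℂ)) • X))) t := by
  have h := (hasDerivAt_exp_I_smul X (-t)).scomp t (hasDerivAt_neg t)
  rw [neg_one_smul] at h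
  exact h

/-- The derivative of `e^{iXτ} O e^{-iXτ}`. -/
lemma hasDerivAt_exp_I_conj (X O : A) (t : ℝ) :
    HasDerivAt (fun τ : ℝ => NormedSpace.exp ((Complex.I * (τ : ℂ)) • X) * O *
        NormedSpace.exp ((Complex.I * ((-τ : ℝ) : ℂ)) • X))
      (Complex.I • ⁅X, NormedSpace.exp ((Complex.I * (t : ℂ)) • X) * O *
        NormedSpace.exp ((Complex.I * ((-t : ℝ) : ℂ)) • X)⁆) t := by
  have h := ((hasDerivAt_exp_I_smul X t).mul_const O).mul (hasDerivAt_exp_I_neg_smul X t)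
  have hc := (commute_exp_smul X (Complex.I * ((-t : ℝ) : ℂ))).eq
  convert! h using 1
  simp only [smul_mul_assoc, mul_neg, mul_smul_comm, hc, Ring.lie_def, smul_sub, mul_assoc]
  abel

/-- The derivative of `e^{-iYτ} f(τ) e^{iYτ}` along a solution `f` of `f' = i[X, f]`. -/
lemma hasDerivAt_exp_neg_I_conj (X Y : A) {f : ℝ → A} {f' : A} {t : ℝ} (hf : HasDerivAt f f' t)
    (hf' : f' = Complex.I • ⁅X, f t⁆) :
    HasDerivAt (fun τ : ℝ => NormedSpace.exp ((Complex.I * ((-τ : ℝ) : ℂ)) • Y) * f τ *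
        NormedSpace.exp ((Complex.I * ((-(-τ) : ℝ) : ℂ)) • Y))
      (Complex.I • (NormedSpace.exp ((Complex.I * ((-t : ℝ) : ℂ)) • Y) * ⁅X - Y, f t⁆ *
        NormedSpace.exp ((Complex.I * ((-(-t) : ℝ) : ℂ)) • Y))) t := by
  have h := ((hasDerivAt_exp_I_neg_smul Y t).mul hf).mul (hasDerivAt_exp_I_smul Y t)
  have hc := (commute_exp_smul Y (Complex.I * ((-t : ℝ) : ℂ))).eq
  simp only [neg_neg]
  convert! h using 1
  rw [hf']
  simp only [smul_mul_assoc, mul_smul_comm, ← smul_neg, ← smul_add, hc, Ring.lie_def, Pi.mul_apply]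
  congr 1
  noncomm_ring

/-- A continuous linear map that respects the powers of `X` respects its exponential. -/
lemma map_exp_of_map_pow {B : Type*} [NormedRing B] [NormedAlgebra ℂ B] [CompleteSpace B] (φ : A →L[ℂ] B) (X : A)
    (h : ∀ j : ℕ, φ (X ^ j) = φ X ^ j) : φ (NormedSpace.exp X) = NormedSpace.exp (φ X) := by
  have h1 := (NormedSpace.exp_series_hasSum_exp' (𝕂 := ℂ) X).mapL φ
  have h2 := NormedSpace.exp_series_hasSum_exp' (𝕂 := ℂ) (φ X)
  simp only [map_smul, h] at h1
  exact h1.unique h2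

/-- Conjugation by `e^X` is the exponential series of the commutator with `X`. -/
lemma hasSum_exp_mul_mul_exp_neg (X O : A) :
    HasSum (fun j : ℕ => ((j.factorial : ℂ)⁻¹) • (fun Y => ⁅X, Y⁆)^[j] O)
      (NormedSpace.exp X * O * NormedSpace.exp (-X)) := by
  set l : A →L[ℂ] A := ContinuousLinearMap.mul ℂ A X with hl
  set r : A →L[ℂ] A := (ContinuousLinearMap.mul ℂ A).flip (-X) with hr
  have hlpow : ∀ (Y : A) (j : ℕ), ContinuousLinearMap.mul ℂ A (Y ^ j) =
      (ContinuousLinearMap.mul ℂ A Y) ^ j := by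
    intro Y j
    induction j with
    | zero => ext; simp
    | succ j ih => rw [pow_succ, pow_succ, ← ih]; ext; simp [mul_assoc]
  have hrpow : ∀ (Y : A) (j : ℕ), (ContinuousLinearMap.mul ℂ A).flip (Y ^ j) =
      ((ContinuousLinearMap.mul ℂ A).flip Y) ^ j := by
    intro Y j
    induction j with
    | zero => ext; simp
    | succ j ih => rw [pow_succ', pow_succ, ← ih]; ext; simp [mul_assoc]
  have hcomm : Commute l r := by
    ext Y; simp [hl, hr, mul_assoc]
  have hexp : NormedSpace.exp (l + r) O = NormedSpace.exp X * O * NormedSpace.exp (-X) := by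
    let +nondep : NormedAlgebra ℚ (A →L[ℂ] A) := .restrictScalars ℚ ℂ (A →L[ℂ] A)
    rw [NormedSpace.exp_add_of_commute hcomm, hl, hr, ← map_exp_of_map_pow _ _ (hlpow X),
      ← map_exp_of_map_pow _ _ (hrpow (-X))]
    simp [mul_assoc]
  have hiter : ∀ j : ℕ, ((l + r) ^ j) O = (fun Y => ⁅X, Y⁆)^[j] O := by
    intro j
    induction j with
    | zero => simp
    | succ j ih =>
      rw [pow_succ', mul_apply_eq_comp, ih, Function.iterate_succ_apply']
      simp [hl, hr, Ring.lie_def, sub_eq_add_neg]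
  have h := (NormedSpace.exp_series_hasSum_exp' (𝕂 := ℂ) (l + r)).mapL
    (ContinuousLinearMap.apply ℂ A O)
  simpa [hexp, hiter] using h

lemma hasSum_exp_smul_mul_mul_exp_smul (z : ℂ) (X O : A) :
    HasSum (fun j : ℕ => ((j.factorial : ℂ)⁻¹ * z ^ j) • (fun Y => ⁅X, Y⁆)^[j] O)
      (NormedSpace.exp (z • X) * O * NormedSpace.exp (-z • X)) := by
  have h := hasSum_exp_mul_mul_exp_neg (z • X) O
  have hiter : ∀ j : ℕ, (fun Y => ⁅z • X, Y⁆)^[j] O = z ^ j • (fun Y => ⁅X, Y⁆)^[j] O := by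
    intro j
    induction j with
    | zero => simp
    | succ j ih =>
      rw [Function.iterate_succ_apply', Function.iterate_succ_apply', ih, Ring.lie_def,
        Ring.lie_def, smul_mul_smul_comm, smul_mul_smul_comm, mul_comm (z ^ j), ← smul_sub,
        ← pow_succ']
  simpa only [hiter, smul_smul, neg_smul] using h

end BanachAlgebra

/-! ### Time evolution -/

section Evolution

open scoped Matrix.Norms.Frobenius

variable {n m : ℕ}

lemma PauliString.toOp_isHermitian (P : PauliString n) : P.toOp.IsHermitian := by
  have h : ∀ (a : PauliLabel) (i j : Fin 2),
      (starRingEnd ℂ) (a.toMatrix j i) = a.toMatrix i j := by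
    intro a i j
    cases a <;> fin_cases i <;> fin_cases j <;> simp [PauliLabel.toMatrix]
  ext v w
  simp [Matrix.conjTranspose_apply, PauliString.toOp, h]

lemma hamiltonian_isHermitian (E : Fin m → PauliString n) (c : Fin m → ℝ) :
    (hamiltonian E c).IsHermitian := by
  simp only [hamiltonian, Matrix.IsHermitian, Matrix.conjTranspose_sum, Matrix.conjTranspose_smul,
    (PauliString.toOp_isHermitian _).eq]
  simp

lemma evolution_mul_neg (H : QubitOp n) (t : ℝ) : evolution H t * evolution H (-t) = 1 := by
  unfold evolution
  rw [← Matrix.exp_add_of_commute, ← add_smul]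
  · simp
  · exact ((Commute.refl H).smul_left _).smul_right _

lemma evolution_neg_mul (H : QubitOp n) (t : ℝ) : evolution H (-t) * evolution H t = 1 := by
  simpa using evolution_mul_neg H (-t)

@[simp] lemma evolution_zero (H : QubitOp n) : evolution H 0 = 1 := by simp [evolution]

lemma commute_evolution {H A : QubitOp n} (h : Commute H A) (t : ℝ) :
    Commute (evolution H t) A := by
  unfold evolution
  exact (h.smul_left _).exp_left

lemma conjTranspose_evolution {H : QubitOp n} (hH : H.IsHermitian) (t : ℝ) :
    (evolution H t).conjTranspose = evolution H (-t) := by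
  unfold evolution
  rw [← Matrix.exp_conjTranspose, Matrix.conjTranspose_smul, hH.eq]
  simp

lemma norm_sq_eq_trace (A : QubitOp n) : ((‖A‖ ^ 2 : ℝ) : ℂ) = (A.conjTranspose * A).trace := by
  rw [frobenius_norm_sq, Matrix.trace, Finset.sum_comm]
  push_cast
  simp [Matrix.mul_apply, ← Complex.conj_mul']

/-- The Frobenius norm is unitarily invariant. -/
lemma norm_evolution_mul {H : QubitOp n} (hH : H.IsHermitian) (t : ℝ) (A : QubitOp n) :
    ‖evolution H t * A‖ = ‖A‖ := by
  have h : ‖evolution H t * A‖ ^ 2 = ‖A‖ ^ 2 := by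
    apply Complex.ofReal_injective
    rw [norm_sq_eq_trace, norm_sq_eq_trace, Matrix.conjTranspose_mul, conjTranspose_evolution hH,
      mul_assoc, ← mul_assoc (evolution H (-t)), evolution_neg_mul, one_mul]
  exact (sq_eq_sq₀ (norm_nonneg _) (norm_nonneg _)).1 h

lemma norm_mul_evolution {H : QubitOp n} (hH : H.IsHermitian) (t : ℝ) (A : QubitOp n) :
    ‖A * evolution H t‖ = ‖A‖ := by
  rw [← Matrix.frobenius_norm_conjTranspose, Matrix.conjTranspose_mul, conjTranspose_evolution hH,
    norm_evolution_mul hH, Matrix.frobenius_norm_conjTranspose]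

/-- The Heisenberg evolution `e^{iHt} A e^{-iHt}`. -/
noncomputable def heisenberg (H : QubitOp n) (t : ℝ) : QubitOp n →ₗ[ℂ] QubitOp n :=
  LinearMap.mulLeftRight ℂ (evolution H t, evolution H (-t))

lemma heisenberg_apply (H : QubitOp n) (t : ℝ) (A : QubitOp n) :
    heisenberg H t A = evolution H t * A * evolution H (-t) := by
  simp [heisenberg]

lemma norm_heisenberg {H : QubitOp n} (hH : H.IsHermitian) (t : ℝ) (A : QubitOp n) :
    ‖heisenberg H t A‖ = ‖A‖ := by
  rw [heisenberg_apply, norm_mul_evolution hH, norm_evolution_mul hH]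

@[simp] lemma heisenberg_zero (H A : QubitOp n) : heisenberg H 0 A = A := by
  simp [heisenberg_apply]

/-- The Heisenberg equation. -/
lemma hasDerivAt_heisenberg (H A : QubitOp n) (t : ℝ) :
    HasDerivAt (fun τ => heisenberg H τ A) (Complex.I • ⁅H, heisenberg H t A⁆) t := by
  simp only [heisenberg_apply, evolution]
  exact hasDerivAt_exp_I_conj H A t

lemma lie_heisenberg (H A : QubitOp n) (t : ℝ) :
    ⁅H, heisenberg H t A⁆ = heisenberg H t ⁅H, A⁆ := by
  have h1 : H * evolution H t = evolution H t * H :=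
    (commute_evolution (Commute.refl H) t).eq.symm
  have h2 : evolution H (-t) * H = H * evolution H (-t) :=
    (commute_evolution (Commute.refl H) (-t)).eq
  simp only [heisenberg_apply, Ring.lie_def, mul_sub, sub_mul, ← mul_assoc, h1]
  simp only [mul_assoc, h2]

/-- In the interaction picture the generator is the difference of the Hamiltonians. -/
lemma hasDerivAt_heisenberg_neg_heisenberg (H H₀ A : QubitOp n) (t : ℝ) :
    HasDerivAt (fun τ => heisenberg H₀ (-τ) (heisenberg H τ A))
      (Complex.I • heisenberg H₀ (-t) ⁅H - H₀, heisenberg H t A⁆) t := by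
  have hX := hasDerivAt_heisenberg H A t
  simp only [heisenberg_apply H₀, evolution]
  exact hasDerivAt_exp_neg_I_conj H H₀ hX rfl

lemma hasSum_heisenberg (H O : QubitOp n) (t : ℝ) :
    HasSum (fun j : ℕ => ((j.factorial : ℂ)⁻¹ * (Complex.I * t) ^ j) • (fun Y => ⁅H, Y⁆)^[j] O)
      (heisenberg H t O) := by
  have h := hasSum_exp_smul_mul_mul_exp_smul (Complex.I * (t : ℂ)) H O
  rw [heisenberg_apply, evolution, evolution, Complex.ofReal_neg, mul_neg]
  exact h

end Evolution

/-! ### The commutator with an evolved local operator -/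

section Locality

open scoped Matrix.Norms.Frobenius

variable {n m : ℕ}

/-- Nested commutators with a local Hamiltonian. Locality grows linearly with the depth, so the
norms grow factorially, which the exponential series compensates. -/
lemma isLocalOp_iterate_lie {k K : ℕ} {E : Fin m → PauliString n} (hE : IsLocalTerms k E)
    {c : Fin m → ℝ} {d : ℝ} (hd : localOneNorm E c ≤ d) {O : QubitOp n} (hO : IsLocalOp K O)
    (j : ℕ) :
    IsLocalOp (K + j * k) ((fun Y => ⁅hamiltonian E c, Y⁆)^[j] O) ∧
      ‖(fun Y => ⁅hamiltonian E c, Y⁆)^[j] O‖ ≤ (2 * d * (K + k)) ^ j * j.factorial * ‖O‖ := by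
  have hd0 : 0 ≤ d := (localOneNorm_nonneg E c).trans hd
  induction j with
  | zero => simpa using hO
  | succ j ih =>
    obtain ⟨ih1, ih2⟩ := ih
    rw [Function.iterate_succ_apply']
    constructor
    · have := isLocalOp_lie_hamiltonian hE c ih1
      convert this using 1
      ring
    · refine (norm_lie_hamiltonian_le hE hd ih1).trans ?_
      have h1 : ((K + j * k : ℕ) : ℝ) + k ≤ (j + 1) * (K + k) := by
        push_cast
        nlinarith [mul_nonneg (Nat.cast_nonneg (α := ℝ) j) (Nat.cast_nonneg (α := ℝ) K)]
      calc 2 * (((K + j * k : ℕ) : ℝ) + k) * d * ‖(fun Y => ⁅hamiltonian E c, Y⁆)^[j] O‖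
          ≤ 2 * ((j + 1) * (K + k)) * d * ((2 * d * (K + k)) ^ j * j.factorial * ‖O‖) := by
            gcongr
        _ = _ := by
            rw [Nat.factorial_succ]; push_cast; ring

/-- Powers of the depth are absorbed by a factorial and a geometric factor. -/
lemma succ_pow_le (j p : ℕ) : ((j : ℝ) + 1) ^ p ≤ p.factorial * Real.exp 1 * Real.exp 1 ^ j := by
  have h := Real.pow_div_factorial_le_exp ((j : ℝ) + 1) (by positivity) p
  rw [div_le_iff₀ (by positivity)] at h
  refine h.trans (le_of_eq ?_)
  rw [Real.exp_add, ← Real.exp_nat_mul, mul_one]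
  ring

/-- For short times the commutator with an evolved local operator is controlled by the local
two-norm, as if the operator had not spread. -/
lemma norm_lie_heisenberg_le {k K : ℕ} (hk : 1 ≤ k) {E : Fin m → PauliString n}
    (hE : IsLocalTerms k E) {c v : Fin m → ℝ} {d η : ℝ} (hd : localOneNorm E c ≤ d)
    (hη : localTwoNorm E v ≤ η) {O : QubitOp n} (hO : IsLocalOp K O) {t : ℝ}
    (ht : 12 * d * (K + k) * |t| ≤ 1) :
    ‖⁅hamiltonian E v, heisenberg (hamiltonian E c) t O⁆‖ ≤
      12 * (5 * (K + k)) ^ (k + 1) * (k + 1).factorial * η * ‖O‖ := by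
  have hd0 : 0 ≤ d := (localOneNorm_nonneg E c).trans hd
  have hη0 : 0 ≤ η := (localTwoNorm_nonneg E v).trans hη
  have hk' : (1 : ℝ) ≤ k := by exact_mod_cast hk
  have hK' : (0 : ℝ) ≤ K := by positivity
  have he : Real.exp 1 ≤ 3 := by linarith [Real.exp_one_lt_d9]
  set V := hamiltonian E v with hV
  set L : ℝ := K + k with hL
  have hL1 : 1 ≤ L := by linarith
  set M : ℝ := 2 * (5 * L) ^ (k + 1) * ((k + 1).factorial * Real.exp 1) * η * ‖O‖ with hM
  set ad : ℕ → QubitOp n := fun j => (fun Y => ⁅hamiltonian E c, Y⁆)^[j] O with had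
  have hsum : HasSum (fun j : ℕ => ((j.factorial : ℂ)⁻¹ * (Complex.I * t) ^ j) • ⁅V, ad j⁆)
      ⁅V, heisenberg (hamiltonian E c) t O⁆ :=
    hasSum_smul_lie V (hasSum_heisenberg (hamiltonian E c) O t)
  have hterm : ∀ j : ℕ, ‖((j.factorial : ℂ)⁻¹ * (Complex.I * t) ^ j) • ⁅V, ad j⁆‖ ≤
      M * (1 / 2) ^ j := by
    intro j
    obtain ⟨h1, h2⟩ := isLocalOp_iterate_lie hE hd hO j
    have h3 := norm_lie_hamiltonian_le_of_localTwoNorm hE hη h1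
    have hf : (0 : ℝ) < j.factorial := by exact_mod_cast j.factorial_pos
    have h4 : 4 * (((K + j * k : ℕ) : ℝ) + k) + 1 ≤ (5 * L) * (j + 1) := by
      push_cast
      nlinarith [mul_nonneg (Nat.cast_nonneg (α := ℝ) j) hK',
        mul_nonneg (Nat.cast_nonneg (α := ℝ) j) (zero_le_one.trans hk')]
    have h5 : Real.exp 1 * (2 * d * L * |t|) ≤ 1 / 2 := by
      have : 0 ≤ 2 * d * L * |t| := by positivity
      nlinarith
    have hn : ‖((j.factorial : ℂ)⁻¹ * (Complex.I * t) ^ j)‖ = (j.factorial : ℝ)⁻¹ * |t| ^ j := by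
      simp
    rw [norm_smul, hn]
    calc (j.factorial : ℝ)⁻¹ * |t| ^ j * ‖⁅V, ad j⁆‖
        ≤ (j.factorial : ℝ)⁻¹ * |t| ^ j * (2 * (4 * (((K + j * k : ℕ) : ℝ) + k) + 1) ^ (k + 1) *
            η * ((2 * d * L) ^ j * j.factorial * ‖O‖)) := by
          gcongr
          exact h3.trans (by gcongr)
      _ ≤ (j.factorial : ℝ)⁻¹ * |t| ^ j * (2 * ((5 * L) * (j + 1)) ^ (k + 1) *
            η * ((2 * d * L) ^ j * j.factorial * ‖O‖)) := by
          gcongr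
      _ = 2 * (5 * L) ^ (k + 1) * ((j : ℝ) + 1) ^ (k + 1) * η * ‖O‖ * (2 * d * L * |t|) ^ j := by
          rw [mul_pow (5 * L), mul_pow (2 * d * L) |t|]
          field_simp
      _ ≤ 2 * (5 * L) ^ (k + 1) * ((k + 1).factorial * Real.exp 1 * Real.exp 1 ^ j) * η * ‖O‖ *
            (2 * d * L * |t|) ^ j := by
          gcongr
          exact succ_pow_le j (k + 1)
      _ = M * (Real.exp 1 * (2 * d * L * |t|)) ^ j := by
          rw [hM, mul_pow (Real.exp 1)]; ring
      _ ≤ M * (1 / 2) ^ j := by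
          gcongr
  have hgeom : HasSum (fun j : ℕ => M * (1 / 2 : ℝ) ^ j) (M * 2) := hasSum_geometric_two.mul_left M
  refine (HasSum.norm_le_of_bounded hsum hgeom hterm).trans ?_
  have hpos : 0 ≤ (5 * L) ^ (k + 1) * (k + 1).factorial * η * ‖O‖ := by positivity
  rw [hM]
  nlinarith

end Locality

/-! ### Iterating one step -/

section Step

open scoped Matrix.Norms.Frobenius

variable {n m : ℕ}

/-- One step of the alternating evolution. -/
noncomputable def interactionStep (H H₀ : QubitOp n) (t : ℝ) : QubitOp n →ₗ[ℂ] QubitOp n :=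
  (heisenberg H₀ (-t)).comp (heisenberg H t)

lemma interactionStep_apply (H H₀ : QubitOp n) (t : ℝ) (A : QubitOp n) :
    interactionStep H H₀ t A = evolution H₀ (-t) * evolution H t * A *
      (evolution H (-t) * evolution H₀ t) := by
  simp [interactionStep, heisenberg_apply, mul_assoc]

lemma interactionStep_iterate (H H₀ : QubitOp n) (t : ℝ) (A : QubitOp n) (s : ℕ) :
    (interactionStep H H₀ t)^[s] A = (evolution H₀ (-t) * evolution H t) ^ s * A *
      (evolution H (-t) * evolution H₀ t) ^ s := by
  induction s with
  | zero => simp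
  | succ s ih =>
    rw [Function.iterate_succ_apply', ih, interactionStep_apply, pow_succ', pow_succ]
    simp only [mul_assoc]

lemma norm_interactionStep {H H₀ : QubitOp n} (hH : H.IsHermitian) (hH₀ : H₀.IsHermitian) (t : ℝ)
    (A : QubitOp n) : ‖interactionStep H H₀ t A‖ = ‖A‖ := by
  rw [interactionStep, LinearMap.comp_apply, norm_heisenberg hH₀, norm_heisenberg hH]

/-- Iterating a linear isometry `Φ` on `P`: if `Φ P` is close to `P + D` and `Φ D` is close to `D`,
then `Φ^s P` is close to `P + s D`. -/
lemma norm_iterate_sub_sub_smul_le {A : Type*} [NormedAddCommGroup A] [NormedSpace ℂ A]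
    (Φ : A →ₗ[ℂ] A) (hΦ : ∀ X, ‖Φ X‖ = ‖X‖) {P D : A} {ε δ : ℝ} (hP : ‖Φ P - P - D‖ ≤ ε)
    (hD : ‖Φ D - D‖ ≤ δ) (s : ℕ) : ‖Φ^[s] P - P - (s : ℂ) • D‖ ≤ s * ε + s ^ 2 * δ := by
  have hδ : 0 ≤ δ := (norm_nonneg _).trans hD
  induction s with
  | zero => simp
  | succ s ih =>
    have e : Φ^[s + 1] P - P - ((s + 1 : ℕ) : ℂ) • D =
        Φ (Φ^[s] P - P - (s : ℂ) • D) + (Φ P - P - D) + (s : ℂ) • (Φ D - D) := by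
      rw [Function.iterate_succ_apply', map_sub, map_sub, map_smul]
      push_cast
      module
    rw [e]
    refine (norm_add₃_le).trans ?_
    rw [hΦ, norm_smul, Complex.norm_natCast]
    have : (s : ℝ) * ‖Φ D - D‖ ≤ s * δ := by gcongr
    push_cast
    nlinarith [mul_nonneg (Nat.cast_nonneg (α := ℝ) s) hδ]

lemma hasDerivAt_interactionStep (H H₀ A : QubitOp n) (t : ℝ) :
    HasDerivAt (fun τ => interactionStep H H₀ τ A)
      (Complex.I • heisenberg H₀ (-t) ⁅H - H₀, heisenberg H t A⁆) t :=
  hasDerivAt_heisenberg_neg_heisenberg H H₀ A t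

@[simp] lemma interactionStep_zero (H H₀ A : QubitOp n) : interactionStep H H₀ 0 A = A := by
  simp [interactionStep]

lemma norm_interactionStep_sub_le {H H₀ : QubitOp n} (hH₀ : H₀.IsHermitian) {A : QubitOp n}
    {t B : ℝ} (hB : ∀ τ, |τ| ≤ |t| → ‖⁅H - H₀, heisenberg H τ A⁆‖ ≤ B) :
    ‖interactionStep H H₀ t A - A‖ ≤ |t| * B := by
  have h := norm_sub_le_of_hasDerivAt (B := B) (t := t)
    (fun τ => hasDerivAt_interactionStep H H₀ A τ) (fun τ hτ => by
      rw [norm_smul, Complex.norm_I, one_mul, norm_heisenberg hH₀]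
      exact hB τ hτ)
  simpa using h

lemma norm_heisenberg_sub_le {H : QubitOp n} (hH : H.IsHermitian) (A : QubitOp n) (t : ℝ) :
    ‖heisenberg H t A - A‖ ≤ |t| * ‖⁅H, A⁆‖ := by
  have h := norm_sub_le_of_hasDerivAt (B := ‖⁅H, A⁆‖) (t := t)
    (fun τ => hasDerivAt_heisenberg H A τ) (fun τ _ => by
      rw [norm_smul, Complex.norm_I, one_mul, lie_heisenberg, norm_heisenberg hH])
  simpa using h

/-- The second-order error of one step. -/
lemma norm_interactionStep_sub_sub_le {H H₀ : QubitOp n} (hH₀ : H₀.IsHermitian) {A : QubitOp n}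
    {t B : ℝ} (hB : ∀ τ, |τ| ≤ |t| → ‖⁅H - H₀, heisenberg H τ ⁅H, A⁆⁆‖ ≤ B) :
    ‖interactionStep H H₀ t A - A - (Complex.I * t) • ⁅H - H₀, A⁆‖ ≤
      |t| * (|t| * B + |t| * ‖⁅H₀, ⁅H - H₀, A⁆⁆‖) := by
  set Y := ⁅H - H₀, A⁆ with hY
  -- the commutator with the evolved operator differs from `Y` at first order in time
  have h1 : ∀ τ, |τ| ≤ |t| → ‖⁅H - H₀, heisenberg H τ A⁆ - Y‖ ≤ |t| * B := by
    intro τ hτ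
    have hB0 : 0 ≤ B := (norm_nonneg _).trans (hB τ hτ)
    have hder : ∀ σ, HasDerivAt (fun σ => ⁅H - H₀, heisenberg H σ A⁆)
        (Complex.I • ⁅H - H₀, heisenberg H σ ⁅H, A⁆⁆) σ := by
      intro σ
      have h := hasDerivAt_heisenberg H A σ
      rw [lie_heisenberg] at h
      exact hasDerivAt_lie (H - H₀) h
    have h := norm_sub_le_of_hasDerivAt (B := B) (t := τ) hder (fun σ hσ => by
      rw [norm_smul, Complex.norm_I, one_mul]
      exact hB σ (hσ.trans hτ))
    rw [heisenberg_zero] at h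
    exact h.trans (by gcongr)
  have hder : ∀ τ, HasDerivAt (fun τ : ℝ => interactionStep H H₀ τ A - (Complex.I * τ) • Y)
      (Complex.I • heisenberg H₀ (-τ) ⁅H - H₀, heisenberg H τ A⁆ - Complex.I • Y) τ := by
    intro τ
    exact (hasDerivAt_interactionStep H H₀ A τ).sub (hasDerivAt_I_mul_smul Y τ)
  have h := norm_sub_le_of_hasDerivAt (t := t) (B := |t| * B + |t| * ‖⁅H₀, Y⁆‖) hder (by
    intro τ hτ
    have e : heisenberg H₀ (-τ) ⁅H - H₀, heisenberg H τ A⁆ - Y =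
        heisenberg H₀ (-τ) (⁅H - H₀, heisenberg H τ A⁆ - Y) + (heisenberg H₀ (-τ) Y - Y) := by
      rw [map_sub]; abel
    rw [← smul_sub, norm_smul, Complex.norm_I, one_mul, e]
    refine (norm_add_le _ _).trans (add_le_add ?_ ?_)
    · rw [norm_heisenberg hH₀]
      exact h1 τ hτ
    · refine (norm_heisenberg_sub_le hH₀ Y (-τ)).trans ?_
      rw [abs_neg]
      gcongr)
  have e : interactionStep H H₀ t A - A - (Complex.I * t) • Y =
      interactionStep H H₀ t A - (Complex.I * t) • Y -
        (interactionStep H H₀ 0 A - (Complex.I * (0 : ℝ)) • Y) := by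
    simp only [interactionStep_zero, Complex.ofReal_zero, mul_zero, zero_smul, sub_zero]
    abel
  rw [e]
  exact h

end Step

/-! ### Numerical bounds and the error estimate -/

section Final

open scoped Matrix.Norms.Frobenius

variable {n m : ℕ}

lemma frobNorm_zero : frobNorm (0 : QubitOp n) = 0 := norm_zero (E := QubitOp n)

lemma frobNorm_nonneg (A : QubitOp n) : 0 ≤ frobNorm A := norm_nonneg A

lemma hamiltonian_sub (E : Fin m → PauliString n) (c c₀ : Fin m → ℝ) :
    hamiltonian E (c - c₀) = hamiltonian E c - hamiltonian E c₀ := by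
  simp [hamiltonian, sub_smul, Finset.sum_sub_distrib]

/-- A product of constants and powers of the locality, absorbed in one power of `x ≥ 2`. -/
lemma seriesBound_le {k : ℕ} (hk : 1 ≤ k) {x L : ℝ} (hkx : (k : ℝ) + 1 ≤ x) (hL0 : 0 ≤ L)
    (hL : L ≤ 2 * x) : 12 * (5 * L) ^ (k + 1) * (k + 1).factorial ≤ x ^ (16 * k) := by
  have hk' : (1 : ℝ) ≤ k := by exact_mod_cast hk
  have hx : 2 ≤ x := by linarith
  have h16 : 16 ≤ x ^ 4 := by
    calc (16 : ℝ) = 2 ^ 4 := by norm_num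
      _ ≤ x ^ 4 := by gcongr
  have hfac : ((k + 1).factorial : ℝ) ≤ x ^ (k + 1) := by
    have h : ((k + 1).factorial : ℝ) ≤ ((k + 1 : ℕ) : ℝ) ^ (k + 1) := by
      exact_mod_cast Nat.factorial_le_pow (k + 1)
    refine h.trans ?_
    push_cast
    gcongr
  have h5L : 5 * L ≤ x ^ 4 * x := by nlinarith
  calc 12 * (5 * L) ^ (k + 1) * (k + 1).factorial
      ≤ x ^ 4 * (x ^ 4 * x) ^ (k + 1) * x ^ (k + 1) := by
        gcongr
        linarith
    _ = x ^ (4 + 6 * (k + 1)) := by rw [← pow_succ, ← pow_mul, ← pow_add, ← pow_add]; ring_nf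
    _ ≤ x ^ (16 * k) := pow_le_pow_right₀ (by linarith) (by omega)

lemma commutatorBound_le {k : ℕ} (hk : 1 ≤ k) {x : ℝ} (hx : 2 ≤ x) :
    2 * (4 * x + 1) ^ (k + 1) ≤ x ^ (16 * k) := by
  have h8 : 8 ≤ x ^ 3 := by
    calc (8 : ℝ) = 2 ^ 3 := by norm_num
      _ ≤ x ^ 3 := by gcongr
  have h : 4 * x + 1 ≤ x ^ 3 * x := by nlinarith
  calc 2 * (4 * x + 1) ^ (k + 1) ≤ x * (x ^ 3 * x) ^ (k + 1) := by gcongr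
    _ = x ^ (1 + 4 * (k + 1)) := by rw [← pow_succ, ← pow_mul, pow_add, pow_one]
    _ ≤ x ^ (16 * k) := pow_le_pow_right₀ (by linarith) (by omega)

/-- The error estimate in the nondegenerate case. -/
lemma norm_iterate_interactionStep_le {k K : ℕ} (hk : 1 ≤ k) (hK : 1 ≤ K)
    {E : Fin m → PauliString n} (hE : IsLocalTerms k E) {c c₀ : Fin m → ℝ} {d η : ℝ}
    (hd : localOneNorm E c ≤ d) (hd₀ : localOneNorm E c₀ ≤ d)
    (hη : localTwoNorm E (c - c₀) ≤ η) {P : QubitOp n} (hP : IsLocalOp K P) {t : ℝ}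
    (ht : |t| * (d * ((K : ℝ) + k) ^ 32) < 1) (s : ℕ) :
    ‖(interactionStep (hamiltonian E c) (hamiltonian E c₀) t)^[s] P - P -
        (s : ℂ) • ((Complex.I * t) • ⁅hamiltonian E c - hamiltonian E c₀, P⁆)‖ ≤
      (η * s * t ^ 2 * d + η ^ 2 * s ^ 2 * t ^ 2) * ((K : ℝ) + k) ^ (32 * k) * ‖P‖ := by
  have hd0 : 0 ≤ d := (localOneNorm_nonneg E c).trans hd
  have hη0 : 0 ≤ η := (localTwoNorm_nonneg E _).trans hη
  have hk' : (1 : ℝ) ≤ k := by exact_mod_cast hk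
  have hK' : (1 : ℝ) ≤ K := by exact_mod_cast hK
  have hH := hamiltonian_isHermitian E c
  have hH₀ := hamiltonian_isHermitian E c₀
  set H := hamiltonian E c with hHdef
  set H₀ := hamiltonian E c₀ with hH₀def
  have hV : hamiltonian E (c - c₀) = H - H₀ := hamiltonian_sub E c c₀
  set x : ℝ := K + k with hx
  have hx2 : 2 ≤ x := by linarith
  set W : ℝ := x ^ (16 * k) with hW
  have hW0 : 0 ≤ W := by positivity
  set Y := ⁅H - H₀, P⁆ with hY
  have hYloc : IsLocalOp (K + k) Y := by
    rw [hY, ← hV]; exact isLocalOp_lie_hamiltonian hE _ hP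
  have hYnorm : ‖Y‖ ≤ W * η * ‖P‖ := by
    rw [hY, ← hV]
    refine (norm_lie_hamiltonian_le_of_localTwoNorm hE hη hP).trans ?_
    gcongr
    exact commutatorBound_le hk hx2
  have ht' : 12 * d * (x + k) * |t| ≤ 1 := by
    have h32 : (32 : ℝ) ≤ x ^ 5 := by
      calc (32 : ℝ) = 2 ^ 5 := by norm_num
        _ ≤ x ^ 5 := by gcongr
    calc 12 * d * (x + k) * |t| ≤ |t| * (d * (x ^ 5 * x)) := by
          have : 12 * (x + k) ≤ x ^ 5 * x := by nlinarith
          calc 12 * d * (x + k) * |t| = |t| * (d * (12 * (x + k))) := by ring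
            _ ≤ _ := by gcongr
      _ = |t| * (d * x ^ 6) := by ring
      _ ≤ |t| * (d * x ^ 32) := by
          gcongr
          · linarith
          · norm_num
      _ ≤ 1 := ht.le
  -- the commutator with the evolution of a `(K + k)`-local operator
  have key : ∀ {O : QubitOp n}, IsLocalOp (K + k) O → ∀ τ, |τ| ≤ |t| →
      ‖⁅H - H₀, heisenberg H τ O⁆‖ ≤ W * η * ‖O‖ := by
    intro O hO τ hτ
    rw [← hV]
    refine (norm_lie_heisenberg_le hk hE hd hη hO (t := τ) ?_).trans ?_
    · push_cast
      refine le_trans ?_ ht'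
      gcongr
    · push_cast
      gcongr
      exact seriesBound_le hk (by linarith) (by linarith) (by linarith)
  have hHP : ‖⁅H, P⁆‖ ≤ 2 * x * d * ‖P‖ := norm_lie_hamiltonian_le hE hd hP
  have hH₀Y : ‖⁅H₀, Y⁆‖ ≤ 4 * x * d * (W * η * ‖P‖) := by
    refine (norm_lie_hamiltonian_le hE hd₀ hYloc).trans ?_
    push_cast
    gcongr ?_ * d * ?_
    linarith
  have hstep : ‖interactionStep H H₀ t P - P - (Complex.I * t) • Y‖ ≤
      |t| * (|t| * (W * η * (2 * x * d * ‖P‖)) + |t| * (4 * x * d * (W * η * ‖P‖))) := by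
    refine (norm_interactionStep_sub_sub_le hH₀
      (key (isLocalOp_lie_hamiltonian hE c hP))).trans ?_
    gcongr
  have hdrift : ‖interactionStep H H₀ t ((Complex.I * t) • Y) - (Complex.I * t) • Y‖ ≤
      |t| * (|t| * (W * η * (W * η * ‖P‖))) := by
    rw [map_smul, ← smul_sub, norm_smul]
    have h1 : ‖Complex.I * (t : ℂ)‖ = |t| := by simp
    rw [h1]
    gcongr
    refine (norm_interactionStep_sub_le hH₀ (key hYloc)).trans ?_
    gcongr
  refine (norm_iterate_sub_sub_smul_le _ (norm_interactionStep hH hH₀ t) hstep hdrift s).trans ?_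
  have h8 : 8 ≤ x ^ 3 := by
    calc (8 : ℝ) = 2 ^ 3 := by norm_num
      _ ≤ x ^ 3 := by gcongr
  have hxW : 6 * x * W ≤ x ^ (32 * k) := by
    calc 6 * x * W ≤ x ^ 3 * x * W := by gcongr; linarith
      _ = x ^ (4 + 16 * k) := by rw [hW, ← pow_succ, ← pow_add]
      _ ≤ x ^ (32 * k) := pow_le_pow_right₀ (by linarith) (by omega)
  have hWW : W * W = x ^ (32 * k) := by rw [hW, ← pow_add]; ring_nf
  calc (s : ℝ) * (|t| * (|t| * (W * η * (2 * x * d * ‖P‖)) + |t| * (4 * x * d * (W * η * ‖P‖)))) +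
        s ^ 2 * (|t| * (|t| * (W * η * (W * η * ‖P‖))))
      = η * s * |t| ^ 2 * d * (6 * x * W) * ‖P‖ + η ^ 2 * s ^ 2 * |t| ^ 2 * (W * W) * ‖P‖ := by ring
    _ ≤ η * s * |t| ^ 2 * d * x ^ (32 * k) * ‖P‖ +
          η ^ 2 * s ^ 2 * |t| ^ 2 * x ^ (32 * k) * ‖P‖ := by
        rw [hWW]
        gcongr
    _ = _ := by rw [sq_abs]; ring

end Final

/-- If no term, or no factor of `P`, is nontrivial, then `P` commutes with the Hamiltonian. -/
lemma commute_hamiltonian_toOp {n m k K : ℕ} {E : Fin m → PauliString n} (hE : IsLocalTerms k E)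
    (c : Fin m → ℝ) {P : PauliString n} (hP : P.supp.card ≤ K) (h : k = 0 ∨ K = 0) :
    Commute (hamiltonian E c) P.toOp := by
  refine Commute.sum_left _ _ _ fun a _ => Commute.smul_left ?_ _
  rw [commute_iff_lie_eq, PauliString.lie_toOp]
  by_contra hne
  obtain ⟨i, hi, hi', -⟩ := PauliString.exists_of_commPhase_ne_zero (left_ne_zero_of_smul hne)
  have h1 := Finset.card_pos.2 ⟨i, hi⟩
  have h2 := Finset.card_pos.2 ⟨i, hi'⟩
  have := hE.card_supp_le a
  omega

theorem mainTheorem2 :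
    ∃ C : ℕ, ∀ (n m k K : ℕ) (E : Fin m → PauliString n) (c c₀ : Fin m → ℝ) (d η : ℝ)
      (P : PauliString n) (t : ℝ) (s : ℕ),
      IsLocalTerms k E →
      localOneNorm E c ≤ d →
      localOneNorm E c₀ ≤ d →
      localTwoNorm E (c - c₀) ≤ η →
      P.supp.card ≤ K →
      |t| * (d * ((K : ℝ) + k) ^ C) < 1 →
      s * |t| * η ≤ 1 →
      ∃ Err : QubitOp n,
        (evolution (hamiltonian E c₀) (-t) * evolution (hamiltonian E c) t) ^ s * P.toOp *
            (evolution (hamiltonian E c) (-t) * evolution (hamiltonian E c₀) t) ^ s =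
          P.toOp + (Complex.I * s * t) • ⁅hamiltonian E c - hamiltonian E c₀, P.toOp⁆ + Err ∧
        frobNorm Err ≤
          (η * s * t ^ 2 * d + η ^ 2 * s ^ 2 * t ^ 2) * ((K : ℝ) + k) ^ (C * k) *
            frobNorm P.toOp := by
  refine ⟨32, fun n m k K E c c₀ d η P t s hE hd hd₀ hη hP ht _ => ?_⟩
  have hd0 : 0 ≤ d := (localOneNorm_nonneg E c).trans hd
  have hη0 : 0 ≤ η := (localTwoNorm_nonneg E _).trans hη
  rw [← interactionStep_iterate]
  refine ⟨(interactionStep (hamiltonian E c) (hamiltonian E c₀) t)^[s] P.toOp - P.toOp -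
    (s : ℂ) • ((Complex.I * t) • ⁅hamiltonian E c - hamiltonian E c₀, P.toOp⁆), ?_, ?_⟩
  · rw [smul_smul, show (s : ℂ) * (Complex.I * t) = Complex.I * s * t by ring]
    abel
  by_cases h : k = 0 ∨ K = 0
  · have h1 := commute_hamiltonian_toOp hE c hP h
    have h2 := commute_hamiltonian_toOp hE c₀ hP h
    have hstep : interactionStep (hamiltonian E c) (hamiltonian E c₀) t P.toOp = P.toOp := by
      rw [interactionStep_apply, ((commute_evolution h2 _).mul_left (commute_evolution h1 _)).eq,
        mul_assoc, mul_assoc, ← mul_assoc (evolution (hamiltonian E c) t), evolution_mul_neg,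
        one_mul, evolution_neg_mul, mul_one]
    rw [Function.iterate_fixed hstep, commute_iff_lie_eq.1 (h1.sub_left h2), smul_zero, smul_zero,
      sub_zero, sub_self]
    rw [frobNorm_zero]
    have := frobNorm_nonneg P.toOp
    positivity
  · push Not at h
    exact norm_iterate_interactionStep_le (Nat.one_le_iff_ne_zero.2 h.1)
      (Nat.one_le_iff_ne_zero.2 h.2) hE hd hd₀ hη (isLocalOp_toOp hP) ht s
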